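/- Let $\gamma:\mathbb R\to\mathbb R^3$ be a regular $C^2$ curve that is periodic with period $T>0$, let $\beta:\mathbb R\to\mathbb R^3$ be a $C^2$ field of unit vectors, and let $w_-<w_+$ be real functions on $\mathbb R$ that are continuous and piecewise $C^2$ (for a subdivision $0=t_0<\dots<t_n=T$ of the period, both are $C^2$ on each closed interval $[t_{i-1},t_i]$). Suppose that the ruled parametrization $$r(t,u)=\gamma(t)+u\,\beta(t),\qquad w_-(t)\le u\le w_+(t),$$ is regular ($r_t$ and $r_u$ are linearly independent) and developable (its Gauss curvature $K$ vanishes at all points), edges included; in particular the ribbon has no cone points. The ribbon $\mathcal R$ so parametrized, with $t$ running over one period, need not be embedded. It is called *cylindrical* if $\beta(t+T)=\beta(t)$ and $w_\pm(t+T)=w_\pm(t)$ for all $t$, and a *Möbius strip-ribbon* if $\beta(t+T)=-\beta(t)$ and $w_\pm(t+T)=-w_\mp(t)$ for all $t$. The contribution of $\mathcal R$ to the total curvature integral is $$C(\mathcal R)=\iint_{\mathcal R}K\,d\mu+\int_{\partial\mathcal R}\kappa_g\,ds+\sum_{j}\alpha_j ,$$ where $\partial\mathcal R$ consists of the edges $t\mapsto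 r(t,w_\pm(t))$ without their kinks, $\kappa_g$ is the geodesic curvature of the edges with respect to the inward normal, and the $\alpha_j\in(-\pi,\pi)$ are the outer angles ($\pi$ minus the inner angle) at the kinks of the edges. (If the edges have no kinks, the last sum is absent.) **Lemma.** If $\mathcal R$ is a cylindrical closed ribbon, then all the integrals exist and $C(\mathcal R)=0$. If $\mathcal R$ is a Möbius strip-ribbon, then likewise all the integrals exist and $C(\mathcal R)=0$. -/

import Mathlib

open Set MeasureTheory

noncomputable section

namespace Ribbon

/-- Euclidean three-space. -/
abbrev E3 := EuclideanSpace ℝ (Fin 3)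

/-- The vector product of Euclidean three-space. -/
def cross (a b : E3) : E3 := WithLp.toLp 2 (crossProduct a.ofLp b.ofLp)

/-! ### Parametrized surfaces in space -/

section Surface

/-- First partial derivative `∂r/∂t` of a parametrization `r (t, u)`. -/
def partialT (r : ℝ → ℝ → E3) (t u : ℝ) : E3 := deriv (fun s => r s u) t

/-- First partial derivative `∂r/∂u` of a parametrization `r (t, u)`. -/
def partialU (r : ℝ → ℝ → E3) (t u : ℝ) : E3 := deriv (fun v => r t v) u

/-- The unit normal `(r_t × r_u) / ‖r_t × r_u‖`. -/
def unitNormal (r : ℝ → ℝ → E3) (t u : ℝ) : E3 :=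
  ‖cross (partialT r t u) (partialU r t u)‖⁻¹ • cross (partialT r t u) (partialU r t u)

/-- The Gauss curvature `(L N - M ^ 2) / (E G - F ^ 2)`, computed from the coefficients
`E, F, G` and `L, M, N` of the first and the second fundamental form. -/
def gaussCurvature (r : ℝ → ℝ → E3) (t u : ℝ) : ℝ :=
  (inner ℝ (partialT (partialT r) t u) (unitNormal r t u) *
      inner ℝ (partialU (partialU r) t u) (unitNormal r t u)
    - inner ℝ (partialT (partialU r) t u) (unitNormal r t u) ^ 2) /
  (inner ℝ (partialT r t u) (partialT r t u) * inner ℝ (partialU r t u) (partialU r t u)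
    - inner ℝ (partialT r t u) (partialU r t u) ^ 2)

/-- The density of the area measure of the surface with respect to `dt du`. -/
def areaDensity (r : ℝ → ℝ → E3) (t u : ℝ) : ℝ :=
  ‖cross (partialT r t u) (partialU r t u)‖

end Surface

/-- Signed geodesic curvature `⟨c'', n × c'⟩ / ‖c'‖ ^ 3` at time `t` of a curve `c` on a surface
with unit normal `n` at `c t`; it is positive where the curve turns towards `n × c'`. -/
def geodesicCurvature (c : ℝ → E3) (n : E3) (t : ℝ) : ℝ :=
  inner ℝ (deriv (deriv c) t) (cross n (deriv c t)) / ‖deriv c t‖ ^ 3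

/-- The angle in `(-π, π]` from `a` to `b`, two vectors orthogonal to the unit vector `n`, in
their plane oriented by `n`. -/
def signedAngle (n a b : E3) : ℝ :=
  Complex.arg ⟨inner ℝ a b, inner ℝ n (cross a b)⟩

/-- A developable ruled ribbon `r (t, u) = γ t + u • β t`, `lower t ≤ u ≤ upper t`, along a closed
regular center curve `γ`. All data are defined for every real `t`, and `t` and `t + period` stand
for the same ruling; how the rulings `t` and `t + period` are glued is specified by
`IsCylindrical` and `IsMobius` below. The two width functions are piecewise `C²`
with respect to a common subdivision of one period. -/
structure DevelopableRibbon where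
  /-- The period of the center curve. -/
  period : ℝ
  period_pos : 0 < period
  /-- The center curve `γ`. -/
  center : ℝ → E3
  center_contDiff : ContDiff ℝ 2 center
  center_closed : ∀ t, center (t + period) = center t
  center_regular : ∀ t, deriv center t ≠ 0
  /-- The unit vector field `β` along `γ` that spans the rulings. -/
  ruling : ℝ → E3
  ruling_contDiff : ContDiff ℝ 2 ruling
  ruling_unit : ∀ t, ‖ruling t‖ = 1
  /-- The width function that bounds the ruling parameter from below. -/
  lower : ℝ → ℝ
  /-- The width function that bounds the ruling parameter from above. -/
  upper : ℝ → ℝ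
  lower_lt_upper : ∀ t, lower t < upper t
  /-- The number of pieces into which a period is divided. -/
  pieces : ℕ
  /-- The points of subdivision, where the edges may have kinks. -/
  kink : Fin (pieces + 1) → ℝ
  kink_strictMono : StrictMono kink
  kink_zero : kink 0 = 0
  kink_last : kink (Fin.last pieces) = period
  lower_contDiffOn : ∀ i : Fin pieces,
    ContDiffOn ℝ 2 lower (Icc (kink i.castSucc) (kink i.succ))
  upper_contDiffOn : ∀ i : Fin pieces,
    ContDiffOn ℝ 2 upper (Icc (kink i.castSucc) (kink i.succ))
  /-- The parametrization is regular on the whole ribbon, edges included. -/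
  regular : ∀ t, ∀ u ∈ Icc (lower t) (upper t),
    LinearIndependent ℝ
      ![partialT (fun s v => center s + v • ruling s) t u,
        partialU (fun s v => center s + v • ruling s) t u]
  /-- The ribbon is developable: its Gauss curvature vanishes at all points. -/
  flat : ∀ t, ∀ u ∈ Icc (lower t) (upper t),
    gaussCurvature (fun s v => center s + v • ruling s) t u = 0

namespace DevelopableRibbon

variable (R : DevelopableRibbon)

/-- The ruled parametrization of the ribbon. -/
def param (t u : ℝ) : E3 := R.center t + u • R.ruling t

/-- After one turn each ruling comes back with its direction unchanged: the ribbon is a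
cylinder (annulus). -/
def IsCylindrical : Prop :=
  (∀ t, R.ruling (t + R.period) = R.ruling t) ∧
  (∀ t, R.lower (t + R.period) = R.lower t) ∧
  (∀ t, R.upper (t + R.period) = R.upper t)

/-- After one turn each ruling comes back with its direction reversed, so that
`(t + period, u)` and `(t, -u)` are the same point and the two edges are exchanged: the ribbon is
a Möbius strip. -/
def IsMobius : Prop :=
  (∀ t, R.ruling (t + R.period) = -R.ruling t) ∧
  (∀ t, R.lower (t + R.period) = -R.upper t) ∧
  (∀ t, R.upper (t + R.period) = -R.lower t)

/-- One period of the parameter domain. -/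
def domain : Set (ℝ × ℝ) :=
  {p | p.1 ∈ Ico 0 R.period ∧ p.2 ∈ Icc (R.lower p.1) (R.upper p.1)}

/-- Gauss curvature times area density, as a function on the parameter domain. -/
def surfaceIntegrand (p : ℝ × ℝ) : ℝ :=
  gaussCurvature R.param p.1 p.2 * areaDensity R.param p.1 p.2

/-- The curve `t ↦ r (t, w t)` on the ribbon; `w` is one of the two width functions. -/
def edge (w : ℝ → ℝ) (t : ℝ) : E3 := R.param t (w t)

/-- The element `κ ds` of the integral of geodesic curvature of the curve `R.edge w`, with respect
to the side to which `r_u` points. -/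
def edgeIntegrand (w : ℝ → ℝ) (t : ℝ) : ℝ :=
  geodesicCurvature (R.edge w) (unitNormal R.param t (w t)) t * ‖deriv (R.edge w) t‖

/-- The turning angle of the curve `R.edge w` at time `t`, from its left-sided to its right-sided
tangent vector, counted positively towards the side to which `r_u` points. -/
def turningAngle (w : ℝ → ℝ) (t : ℝ) : ℝ :=
  signedAngle (unitNormal R.param t (w t))
    (derivWithin (R.edge w) (Iic t) t) (derivWithin (R.edge w) (Ici t) t)

/-- The integral of the Gauss curvature over the ribbon. -/
def surfaceContribution : ℝ := ∫ p in R.domain, R.surfaceIntegrand p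

/-- The integral over the smooth parts of the edges of the geodesic curvature with respect to the
inward normal. The ribbon lies on the side of `r_u` along the lower edge and on the opposite side
along the upper edge, hence the signs. -/
def edgeContribution : ℝ :=
  (∫ t in (0 : ℝ)..R.period, R.edgeIntegrand R.lower t) -
    ∫ t in (0 : ℝ)..R.period, R.edgeIntegrand R.upper t

/-- The sum of the outer angles (`π` minus inner angle) at the kinks of the edges. -/
def kinkContribution : ℝ :=
  ∑ i : Fin R.pieces, (R.turningAngle R.lower (R.kink i.castSucc) -
    R.turningAngle R.upper (R.kink i.castSucc))

/-- The integrals that enter the total curvature of the ribbon exist. -/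
def HasFiniteCurvature : Prop :=
  IntegrableOn R.surfaceIntegrand R.domain ∧
  IntervalIntegrable (R.edgeIntegrand R.lower) volume 0 R.period ∧
  IntervalIntegrable (R.edgeIntegrand R.upper) volume 0 R.period

/-- The contribution of the ribbon to the total curvature integral: the surface integral of the
Gauss curvature, the integral of the geodesic curvature along the edges, and the outer angles at
the kinks of the edges. -/
def totalCurvature : ℝ :=
  R.surfaceContribution + R.edgeContribution + R.kinkContribution

end DevelopableRibbon

end Ribbon

end

open Set MeasureTheory

noncomputable section

namespace Ribbon


/-! ### Vector algebra -/

/-! The surface term vanishes because K = 0. On an edge, let θ be the angle by which the tangent is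
inclined from the direction orthogonal to the ruling β towards β. Edges are never tangent to
rulings, so θ lies in (-π/2, π/2) and is a plain arctangent, with no multiples of 2π to control.

By `hasDerivAt_inclination`, κ ds = dθ - ρ dt, where ρ is the rotation of the rulings inside the
tangent plane. Flatness makes β' tangent to the ribbon; it is also orthogonal to β, so ρ = ±‖β'‖. A
change of sign along a ruling would need an intermediate zero of ⟨r_t, β'⟩, which forces β' = 0.
Thus ρ does not depend on u (`rotation_eq`) and cancels between the two edges, which are counted
with opposite signs.

At a kink the outer angle is the jump of θ (`turningAngle_eq`). Everything telescopes, and C is the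
increment of θ_lower - θ_upper over one period (`totalCurvature_eq`). On a cylinder this difference
is periodic. On a Möbius strip the edges are exchanged and θ changes sign, so the difference returns
to itself too. -/

theorem inner_eq_sum_coord (a b : E3) : inner ℝ a b = a 0 * b 0 + a 1 * b 1 + a 2 * b 2 := by
  simp [PiLp.inner_apply, Fin.sum_univ_three, mul_comm]

theorem cross_apply_zero (a b : E3) : cross a b 0 = a 1 * b 2 - a 2 * b 1 := by
  simp [cross, cross_apply]

theorem cross_apply_one (a b : E3) : cross a b 1 = a 2 * b 0 - a 0 * b 2 := by
  simp [cross, cross_apply]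

theorem cross_apply_two (a b : E3) : cross a b 2 = a 0 * b 1 - a 1 * b 0 := by
  simp [cross, cross_apply]

theorem cross_add_smul_left (a b : E3) (s : ℝ) : cross (a + s • b) b = cross a b := by
  ext i
  fin_cases i <;> simp [cross, cross_apply]

theorem cross_add_smul_right (a b : E3) (s : ℝ) : cross a (a + s • b) = s • cross a b := by
  simp [cross]

theorem cross_neg_right (a b : E3) : cross a (-b) = -cross a b := by
  rw [cross, WithLp.ofLp_neg, map_neg, WithLp.toLp_neg, cross]

/-- The double vector product expansion; it turns the numerator of the geodesic curvature into inner
products. -/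
theorem inner_cross_cross_cross (x v b : E3) :
    inner ℝ x (cross (cross v b) v) =
      inner ℝ v v * inner ℝ x b - inner ℝ v b * inner ℝ x v := by
  simp only [inner_eq_sum_coord, cross_apply_zero, cross_apply_one, cross_apply_two]
  ring

theorem norm_cross_sq (v b : E3) :
    ‖cross v b‖ ^ 2 = inner ℝ v v * inner ℝ b b - inner ℝ v b ^ 2 := by
  rw [← real_inner_self_eq_norm_sq]
  simp only [inner_eq_sum_coord, cross_apply_zero, cross_apply_one, cross_apply_two]
  ring

theorem inner_self_of_norm_eq_one {b : E3} (hb : ‖b‖ = 1) : inner ℝ b b = 1 := by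
  rw [real_inner_self_eq_norm_sq, hb, one_pow]

/-- The component orthogonal to a unit vector has length `√(‖v‖ ^ 2 - ⟨v, b⟩ ^ 2)`. -/
theorem norm_cross_eq_sqrt {b : E3} (hb : ‖b‖ = 1) (v : E3) :
    ‖cross v b‖ = √(inner ℝ v v - inner ℝ v b ^ 2) := by
  rw [← Real.sqrt_sq (norm_nonneg (cross v b)), norm_cross_sq, inner_self_of_norm_eq_one hb,
    mul_one]

/-- If `b` is a unit vector orthogonal to `x`, and `x`, `v`, `b` are coplanar, then the component
of `x` along `v` is, up to sign, `‖x‖` times the length of `cross v b`. -/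
theorem inner_sq_eq_of_coplanar {v b x : E3} (hb : ‖b‖ = 1) (hxb : inner ℝ b x = 0)
    (h : inner ℝ x (cross v b) = 0) :
    inner ℝ v x ^ 2 = inner ℝ x x * ‖cross v b‖ ^ 2 := by
  have hb' := inner_self_of_norm_eq_one hb
  -- The squared triple product is the Gram determinant of `x`, `v`, `b`.
  have key : inner ℝ x (cross v b) ^ 2 =
      inner ℝ x x * inner ℝ v v * inner ℝ b b
        + 2 * inner ℝ v x * inner ℝ v b * inner ℝ b x - inner ℝ x x * inner ℝ v b ^ 2
        - inner ℝ v v * inner ℝ b x ^ 2 - inner ℝ b b * inner ℝ v x ^ 2 := by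
    simp only [inner_eq_sum_coord, cross_apply_zero, cross_apply_one, cross_apply_two]
    ring
  rw [norm_cross_sq]
  rw [h, hxb, hb'] at key
  rw [hb']
  linarith

theorem cross_ne_zero_of_linearIndependent {a b : E3} (h : LinearIndependent ℝ ![a, b]) :
    cross a b ≠ 0 := by
  intro h0
  have h1 : LinearIndependent ℝ ![a.ofLp, b.ofLp] := by
    have := h.map' (WithLp.linearEquiv 2 ℝ (Fin 3 → ℝ)).toLinearMap (LinearEquiv.ker _)
    rwa [show ![a.ofLp, b.ofLp] = (WithLp.linearEquiv 2 ℝ (Fin 3 → ℝ)).toLinearMap ∘ ![a, b] by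
      ext i
      fin_cases i <;> rfl]
  rw [← crossProduct_ne_zero_iff_linearIndependent] at h1
  apply h1
  simpa [cross] using congrArg WithLp.ofLp h0

/-! ### The inclination of a direction against a ruling -/

/-- The angle by which `v` is inclined from the normal of the unit vector `b` towards `b`. -/
def inclination (v b : E3) : ℝ := Real.arctan (inner ℝ v b / ‖cross v b‖)

theorem inclination_neg_right (v b : E3) : inclination v (-b) = -inclination v b := by
  simp [inclination, cross_neg_right, neg_div, Real.arctan_neg]

/-- The number is (d + iy)(d - ix). Both factors have positive real part, so the difference of their
arctangents stays in (-π, π) and no branch correction occurs. -/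
theorem arg_mul_conj_eq_arctan_sub {d : ℝ} (hd : 0 < d) (x y : ℝ) :
    Complex.arg ⟨d ^ 2 + x * y, d * (y - x)⟩ = Real.arctan (y / d) - Real.arctan (x / d) := by
  have h1 := Real.neg_pi_div_two_lt_arctan (y / d)
  have h2 := Real.arctan_lt_pi_div_two (y / d)
  have h3 := Real.neg_pi_div_two_lt_arctan (x / d)
  have h4 := Real.arctan_lt_pi_div_two (x / d)
  have hx : 0 < √(1 + (x / d) ^ 2) := by positivity
  have hy : 0 < √(1 + (y / d) ^ 2) := by positivity
  have hr : 0 < d ^ 2 * √(1 + (x / d) ^ 2) * √(1 + (y / d) ^ 2) := by positivity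
  rw [← Complex.arg_mul_cos_add_sin_mul_I hr
    (θ := Real.arctan (y / d) - Real.arctan (x / d)) ⟨by linarith, by linarith⟩]
  congr 1
  rw [← Complex.ofReal_cos, ← Complex.ofReal_sin, Real.cos_sub, Real.sin_sub]
  simp only [Real.cos_arctan, Real.sin_arctan]
  apply Complex.ext
  · simp only [Complex.mul_re, Complex.add_re, Complex.ofReal_re, Complex.ofReal_im,
      Complex.I_re, Complex.I_im, Complex.add_im, Complex.mul_im]
    field_simp
    ring
  · simp only [Complex.mul_re, Complex.add_re, Complex.ofReal_re, Complex.ofReal_im,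
      Complex.I_re, Complex.I_im, Complex.add_im, Complex.mul_im]
    field_simp
    ring

/-- In the plane spanned by `a` and the unit vector `b`, oriented by `cross a b`, the angle from
`a` to `a + s • b` is the difference of the inclinations. -/
theorem signedAngle_add_smul {a b : E3} (hb : ‖b‖ = 1) (h : cross a b ≠ 0) (s : ℝ) :
    signedAngle (‖cross a b‖⁻¹ • cross a b) a (a + s • b) =
      inclination (a + s • b) b - inclination a b := by
  have hd : 0 < ‖cross a b‖ := norm_pos_iff.2 h
  have hb' := inner_self_of_norm_eq_one hb
  rw [inclination, inclination, cross_add_smul_left, ← arg_mul_conj_eq_arctan_sub hd, signedAngle,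
    cross_add_smul_right, norm_cross_sq]
  congr 1
  apply Complex.ext
  · simp only [inner_add_left, inner_add_right, real_inner_smul_left, real_inner_smul_right, hb']
    ring
  · simp only [inner_add_left, real_inner_smul_left, real_inner_smul_right, hb',
      real_inner_self_eq_norm_sq]
    field_simp
    ring

/-- The rate of change of the inclination of the tangent vector `V` of a curve against a field `b`
of unit vectors is the geodesic curvature plus the rotation of `b`. -/
theorem hasDerivAt_inclination {V b : ℝ → E3} {A B : E3} {t : ℝ} (hb : ∀ s, ‖b s‖ = 1)
    (hV : HasDerivAt V A t) (hB : HasDerivAt b B t) (h : cross (V t) (b t) ≠ 0) :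
    HasDerivAt (fun s => inclination (V s) (b s))
      (inner ℝ A (cross (‖cross (V t) (b t)‖⁻¹ • cross (V t) (b t)) (V t)) / ‖V t‖ ^ 3 * ‖V t‖
        + inner ℝ (V t) B / ‖cross (V t) (b t)‖) t := by
  have hd : 0 < ‖cross (V t) (b t)‖ := norm_pos_iff.2 h
  have hv : 0 < ‖V t‖ := by
    refine norm_pos_iff.2 fun h0 => h ?_
    rw [h0]
    simp [cross]
  have hsq := norm_cross_sq (V t) (b t)
  rw [inner_self_of_norm_eq_one (hb t), mul_one] at hsq
  have hp := hV.inner ℝ hB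
  have hq := hV.inner ℝ hV
  have hpq : HasDerivAt (fun s => inner ℝ (V s) (V s) - inner ℝ (V s) (b s) ^ 2) _ t :=
    hq.sub (hp.pow 2)
  -- Since `b` stays a unit vector, the norm is a square root of inner products, differentiable
  -- where positive.
  have hD : HasDerivAt (fun s => ‖cross (V s) (b s)‖) _ t :=
    (hpq.sqrt (hsq ▸ (pow_pos hd 2).ne')).congr_of_eventuallyEq
      (Filter.Eventually.of_forall fun s => norm_cross_eq_sqrt (hb s) (V s))
  have hdiv : HasDerivAt (fun s => inner ℝ (V s) (b s) / ‖cross (V s) (b s)‖) _ t :=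
    hp.div hD hd.ne'
  have hθ := hdiv.arctan
  refine hθ.congr_deriv ?_
  have hc : inner ℝ A (cross (‖cross (V t) (b t)‖⁻¹ • cross (V t) (b t)) (V t)) =
      ‖cross (V t) (b t)‖⁻¹ * (inner ℝ (V t) (V t) * inner ℝ A (b t)
        - inner ℝ (V t) (b t) * inner ℝ A (V t)) := by
    rw [← inner_cross_cross_cross, ← real_inner_smul_right]
    congr 1
    simp [cross]
  simp only [← norm_cross_eq_sqrt (hb t), hc]
  rw [real_inner_comm A (V t)]
  rw [real_inner_self_eq_norm_sq] at hsq ⊢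
  -- What remains is a rational identity, subject only to Pythagoras: v² = d² + p².
  generalize ‖cross (V t) (b t)‖ = d at *
  generalize ‖V t‖ = v at *
  generalize inner ℝ (V t) (b t) = p at *
  have hv2 : v ^ 2 = d ^ 2 + p ^ 2 := by linarith
  have : d ^ 2 + p ^ 2 ≠ 0 := by positivity
  have e : v ^ 3 = v * (d ^ 2 + p ^ 2) := by rw [← hv2]; ring
  rw [e, hv2]
  field_simp
  ring

theorem contDiffOn_inclination {V b : ℝ → E3} {s : Set ℝ} {n : WithTop ℕ∞}
    (hb : ∀ t, ‖b t‖ = 1) (hV : ContDiffOn ℝ n V s) (hB : ContDiffOn ℝ n b s)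
    (h : ∀ t ∈ s, cross (V t) (b t) ≠ 0) :
    ContDiffOn ℝ n (fun t => inclination (V t) (b t)) s := by
  have hp := hV.inner ℝ hB
  have hD : ContDiffOn ℝ n (fun t => ‖cross (V t) (b t)‖) s := by
    refine (((hV.inner ℝ hV).sub (hp.pow 2)).sqrt fun t ht => ?_).congr
      fun t _ => norm_cross_eq_sqrt (hb t) (V t)
    have := norm_cross_sq (V t) (b t)
    rw [inner_self_of_norm_eq_one (hb t), mul_one] at this
    rw [← this]
    exact pow_ne_zero 2 (norm_ne_zero_iff.2 (h t ht))
  exact Real.contDiff_arctan.comp_contDiffOn (hp.div hD fun t ht => norm_ne_zero_iff.2 (h t ht))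

namespace DevelopableRibbon

/-! ### Geometry of the ruled parametrization -/

section Param

variable (R : DevelopableRibbon)

theorem hasDerivAt_center (t : ℝ) : HasDerivAt R.center (deriv R.center t) t :=
  (R.center_contDiff.differentiable (by norm_num) t).hasDerivAt

theorem hasDerivAt_ruling (t : ℝ) : HasDerivAt R.ruling (deriv R.ruling t) t :=
  (R.ruling_contDiff.differentiable (by norm_num) t).hasDerivAt

theorem contDiff_deriv_center : ContDiff ℝ 1 (deriv R.center) :=
  ((contDiff_succ_iff_deriv (n := 1)).1 (one_add_one_eq_two (R := WithTop ℕ∞) ▸ R.center_contDiff)).2.2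

theorem contDiff_deriv_ruling : ContDiff ℝ 1 (deriv R.ruling) :=
  ((contDiff_succ_iff_deriv (n := 1)).1 (one_add_one_eq_two (R := WithTop ℕ∞) ▸ R.ruling_contDiff)).2.2

theorem partialT_param (t u : ℝ) :
    partialT R.param t u = deriv R.center t + u • deriv R.ruling t :=
  ((R.hasDerivAt_center t).add ((R.hasDerivAt_ruling t).const_smul u)).deriv

theorem partialU_param (t u : ℝ) : partialU R.param t u = R.ruling t := by
  have h : HasDerivAt (fun v : ℝ => R.center t + v • R.ruling t) ((1 : ℝ) • R.ruling t) u :=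
    ((hasDerivAt_id u).smul_const (R.ruling t)).const_add (R.center t)
  rw [one_smul] at h
  exact h.deriv

theorem partialT_partialU_param (t u : ℝ) :
    partialT (partialU R.param) t u = deriv R.ruling t := by
  simp only [partialT, partialU_param]

theorem partialU_partialU_param (t u : ℝ) : partialU (partialU R.param) t u = 0 := by
  rw [partialU]
  simp only [partialU_param, deriv_const]

theorem inner_ruling_deriv (t : ℝ) : inner ℝ (R.ruling t) (deriv R.ruling t) = 0 := by
  have h := (R.hasDerivAt_ruling t).inner ℝ (R.hasDerivAt_ruling t)
  simp only [inner_self_of_norm_eq_one (R.ruling_unit _)] at h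
  have h0 := h.unique (hasDerivAt_const t (1 : ℝ))
  rw [real_inner_comm] at h0
  rw [real_inner_comm]
  linarith

theorem cross_partialT_ne_zero {t u : ℝ} (hu : u ∈ Icc (R.lower t) (R.upper t)) :
    cross (partialT R.param t u) (R.ruling t) ≠ 0 := by
  have h := cross_ne_zero_of_linearIndependent (R.regular t u hu)
  rw [← partialU_param R t u]
  exact h

theorem norm_cross_partialT_pos {t u : ℝ} (hu : u ∈ Icc (R.lower t) (R.upper t)) :
    0 < ‖cross (partialT R.param t u) (R.ruling t)‖ :=
  norm_pos_iff.2 (R.cross_partialT_ne_zero hu)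

/-- The vanishing of the Gauss curvature says that the derivative of the ruling is tangent to the
ribbon. -/
theorem inner_deriv_ruling_cross {t u : ℝ} (hu : u ∈ Icc (R.lower t) (R.upper t)) :
    inner ℝ (deriv R.ruling t) (cross (partialT R.param t u) (R.ruling t)) = 0 := by
  have hd := R.norm_cross_partialT_pos hu
  have h : gaussCurvature R.param t u = 0 := R.flat t u hu
  -- As r_uu = 0, the numerator is -M² with M = ⟨β', n⟩; the denominator is ‖r_t × β‖², which is not
  -- zero.
  rw [gaussCurvature, partialU_partialU_param, partialT_partialU_param, unitNormal, partialU_param,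
    ← norm_cross_sq] at h
  simpa [real_inner_smul_right, hd.ne'] using h

/-- The speed at which the rulings rotate, relative to the arc length of their orthogonal
trajectory through the point with parameters `(t, u)`, times its speed. -/
def rotation (t u : ℝ) : ℝ :=
  inner ℝ (partialT R.param t u) (deriv R.ruling t) /
    ‖cross (partialT R.param t u) (R.ruling t)‖

theorem inner_partialT_deriv_ruling_sq {t u : ℝ} (hu : u ∈ Icc (R.lower t) (R.upper t)) :
    inner ℝ (partialT R.param t u) (deriv R.ruling t) ^ 2 =
      inner ℝ (deriv R.ruling t) (deriv R.ruling t) *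
        ‖cross (partialT R.param t u) (R.ruling t)‖ ^ 2 :=
  inner_sq_eq_of_coplanar (R.ruling_unit t) (R.inner_ruling_deriv t) (R.inner_deriv_ruling_cross hu)

/-- The rotation of the rulings is constant along each ruling. -/
theorem rotation_eq {t u v : ℝ} (hu : u ∈ Icc (R.lower t) (R.upper t))
    (hv : v ∈ Icc (R.lower t) (R.upper t)) : R.rotation t u = R.rotation t v := by
  wlog h : inner ℝ (partialT R.param t u) (deriv R.ruling t) ≤
      inner ℝ (partialT R.param t v) (deriv R.ruling t) generalizing u v
  · exact (this hv hu (not_le.1 h).le).symm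
  have su := R.inner_partialT_deriv_ruling_sq hu
  have sv := R.inner_partialT_deriv_ruling_sq hv
  have du := R.norm_cross_partialT_pos hu
  have dv := R.norm_cross_partialT_pos hv
  have aff : ∀ x, inner ℝ (partialT R.param t x) (deriv R.ruling t) =
      inner ℝ (deriv R.center t) (deriv R.ruling t) +
        x * inner ℝ (deriv R.ruling t) (deriv R.ruling t) := fun x => by
    rw [partialT_param, inner_add_left, real_inner_smul_left]
  have hc0 : 0 ≤ inner ℝ (deriv R.ruling t) (deriv R.ruling t) := real_inner_self_nonneg
  have hzero : ∀ x ∈ Icc (R.lower t) (R.upper t),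
      inner ℝ (partialT R.param t x) (deriv R.ruling t) = 0 →
      inner ℝ (deriv R.ruling t) (deriv R.ruling t) = 0 := fun x hx h0 => by
    have := R.inner_partialT_deriv_ruling_sq hx
    rw [h0, zero_pow two_ne_zero] at this
    exact (mul_eq_zero.1 this.symm).resolve_right (pow_pos (R.norm_cross_partialT_pos hx) 2).ne'
  rw [rotation, rotation]
  rcases hc0.eq_or_lt with hc | hc
  · rw [← hc, zero_mul] at su sv
    rw [pow_eq_zero_iff two_ne_zero] at su sv
    rw [su, sv, zero_div, zero_div]
  -- Both squares equal ‖β'‖², so only the signs remain to be compared.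
  · have hsq : (inner ℝ (partialT R.param t u) (deriv R.ruling t) /
        ‖cross (partialT R.param t u) (R.ruling t)‖) ^ 2 =
        (inner ℝ (partialT R.param t v) (deriv R.ruling t) /
        ‖cross (partialT R.param t v) (R.ruling t)‖) ^ 2 := by
      rw [div_pow, div_pow, su, sv, mul_div_cancel_right₀ _ (pow_pos du 2).ne',
        mul_div_cancel_right₀ _ (pow_pos dv 2).ne']
    rcases le_or_gt 0 (inner ℝ (partialT R.param t u) (deriv R.ruling t)) with hqu | hqu
    · exact (sq_eq_sq₀ (div_nonneg hqu du.le) (div_nonneg (hqu.trans h) dv.le)).1 hsq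
    rcases le_or_gt (inner ℝ (partialT R.param t v) (deriv R.ruling t)) 0 with hqv | hqv
    · rw [← neg_sq, ← neg_sq (_ / _), ← neg_div, ← neg_div] at hsq
      have := (sq_eq_sq₀ (div_nonneg (neg_nonneg.2 hqu.le) du.le)
        (div_nonneg (neg_nonneg.2 hqv) dv.le)).1 hsq
      simpa [neg_div] using this
    -- In the case of opposite signs, the witness is the root of the affine function u ↦ ⟨r_t, β'⟩;
    -- it lies between `u` and `v`, hence on the ribbon.
    refine absurd (hzero (-inner ℝ (deriv R.center t) (deriv R.ruling t) /
      inner ℝ (deriv R.ruling t) (deriv R.ruling t)) ?_ ?_) hc.ne'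
    · rw [aff] at hqu hqv
      constructor
      · refine hu.1.trans ?_
        rw [le_div_iff₀ hc]
        linarith
      · refine le_trans ?_ hv.2
        rw [div_le_iff₀ hc]
        linarith
    · rw [aff, div_mul_cancel₀ _ hc.ne']
      ring

end Param

/-! ### Edges -/

section Edge

variable (R : DevelopableRibbon) {w : ℝ → ℝ}

theorem hasDerivWithinAt_edge {w' t : ℝ} {s : Set ℝ} (hw : HasDerivWithinAt w w' s t) :
    HasDerivWithinAt (R.edge w) (partialT R.param t (w t) + w' • R.ruling t) s t := by
  rw [partialT_param, add_assoc]
  exact (R.hasDerivAt_center t).hasDerivWithinAt.add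
    (hw.smul (R.hasDerivAt_ruling t).hasDerivWithinAt)

/-- The inclination, against the ruling, of the one-sided tangent of an edge. -/
def edgeInclination (w : ℝ → ℝ) (s : Set ℝ) (t : ℝ) : ℝ :=
  inclination (derivWithin (R.edge w) s t) (R.ruling t)

/-- A kink of `w` changes the velocity of the edge only by a multiple of the ruling, so both
one-sided tangents have the same component orthogonal to it. -/
theorem turningAngle_eq {t : ℝ} (ht : w t ∈ Icc (R.lower t) (R.upper t))
    (hl : DifferentiableWithinAt ℝ w (Iic t) t) (hr : DifferentiableWithinAt ℝ w (Ici t) t) :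
    R.turningAngle w t = R.edgeInclination w (Ici t) t - R.edgeInclination w (Iic t) t := by
  have h1 := (R.hasDerivWithinAt_edge hl.hasDerivWithinAt).derivWithin (uniqueDiffWithinAt_Iic t)
  have h2 := (R.hasDerivWithinAt_edge hr.hasDerivWithinAt).derivWithin (uniqueDiffWithinAt_Ici t)
  have h3 : derivWithin (R.edge w) (Ici t) t = derivWithin (R.edge w) (Iic t) t +
      (derivWithin w (Ici t) t - derivWithin w (Iic t) t) • R.ruling t := by
    rw [h1, h2]
    module
  have h4 : cross (derivWithin (R.edge w) (Iic t) t) (R.ruling t) =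
      cross (partialT R.param t (w t)) (R.ruling t) := by
    rw [h1, cross_add_smul_left]
  rw [turningAngle, unitNormal, partialU_param, edgeInclination, edgeInclination, h3, ← h4]
  exact signedAngle_add_smul (R.ruling_unit t) (h4 ▸ R.cross_partialT_ne_zero ht) _

variable {a b : ℝ}

/-- On a smooth piece of an edge, the integral of the geodesic curvature is the increment of the
inclination, less the rotation of the rulings. -/
theorem integral_edgeIntegrand (hab : a < b) (hw : ContDiffOn ℝ 2 w (Icc a b))
    (hmem : ∀ t, w t ∈ Icc (R.lower t) (R.upper t)) :
    IntervalIntegrable (R.edgeIntegrand w) volume a b ∧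
      ∫ t in a..b, R.edgeIntegrand w t =
        R.edgeInclination w (Iic b) b - R.edgeInclination w (Ici a) a -
          ∫ t in a..b, R.rotation t (R.lower t) := by
  have hu : UniqueDiffOn ℝ (Icc a b) := uniqueDiffOn_Icc hab
  have hw1 : ContDiffOn ℝ 1 (derivWithin w (Icc a b)) (Icc a b) :=
    hw.derivWithin hu (by norm_num)
  have hwd : DifferentiableOn ℝ w (Icc a b) := hw.differentiableOn (by norm_num)
  -- The tangent, built from the derivative of `w` within the closed piece, is C¹ up to the
  -- endpoints, where the two-sided derivative of the edge may fail to exist.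
  set V : ℝ → E3 := fun t => partialT R.param t (w t) + derivWithin w (Icc a b) t • R.ruling t
    with hVdef
  have hP : ContDiffOn ℝ 1 (fun t => partialT R.param t (w t)) (Icc a b) := by
    simp only [partialT_param]
    exact R.contDiff_deriv_center.contDiffOn.add
      ((hw.of_le (by norm_num)).smul R.contDiff_deriv_ruling.contDiffOn)
  have hβ : ContDiffOn ℝ 1 R.ruling (Icc a b) := (R.ruling_contDiff.of_le (by norm_num)).contDiffOn
  have hV : ContDiffOn ℝ 1 V (Icc a b) := hP.add (hw1.smul hβ)
  have hcross : ∀ t, cross (V t) (R.ruling t) = cross (partialT R.param t (w t)) (R.ruling t) :=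
    fun t => cross_add_smul_left _ _ _
  have hne : ∀ t, cross (V t) (R.ruling t) ≠ 0 := fun t =>
    (hcross t).symm ▸ R.cross_partialT_ne_zero (hmem t)
  have hedge : ∀ t ∈ Icc a b, HasDerivWithinAt (R.edge w) (V t) (Icc a b) t := fun t ht =>
    R.hasDerivWithinAt_edge (hwd t ht).hasDerivWithinAt
  set θ : ℝ → ℝ := fun t => inclination (V t) (R.ruling t) with hθdef
  have hθ : ContDiffOn ℝ 1 θ (Icc a b) :=
    contDiffOn_inclination R.ruling_unit hV hβ fun t _ => hne t
  have hθ' : ContinuousOn (derivWithin θ (Icc a b)) (Icc a b) :=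
    hθ.continuousOn_derivWithin hu le_rfl
  have hρ : ContinuousOn (fun t => R.rotation t (w t)) (Icc a b) := by
    simp only [rotation, norm_cross_eq_sqrt (R.ruling_unit _)]
    refine (hP.continuousOn.inner R.contDiff_deriv_ruling.continuous.continuousOn).div
      (ContinuousOn.sqrt ?_) fun t _ => ?_
    · exact (hP.continuousOn.inner hP.continuousOn).sub
        ((hP.continuousOn.inner hβ.continuousOn).pow 2)
    · rw [← norm_cross_eq_sqrt (R.ruling_unit t)]
      exact (R.norm_cross_partialT_pos (hmem t)).ne'
  have hθi : IntervalIntegrable (derivWithin θ (Icc a b)) volume a b :=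
    hθ'.intervalIntegrable_of_Icc hab.le
  have hρi : IntervalIntegrable (fun t => R.rotation t (w t)) volume a b :=
    hρ.intervalIntegrable_of_Icc hab.le
  have hpt : EqOn (R.edgeIntegrand w)
      (fun t => derivWithin θ (Icc a b) t - R.rotation t (w t)) (Ioo a b) := fun t ht => by
    have hnhds := Icc_mem_nhds ht.1 ht.2
    have hVt : HasDerivAt V (deriv V t) t :=
      ((hV.differentiableOn one_ne_zero t (Ioo_subset_Icc_self ht)).differentiableAt hnhds).hasDerivAt
    have hev : deriv (R.edge w) =ᶠ[nhds t] V := by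
      filter_upwards [Ioo_mem_nhds ht.1 ht.2] with s hs
      exact ((hedge s (Ioo_subset_Icc_self hs)).hasDerivAt (Icc_mem_nhds hs.1 hs.2)).deriv
    have h := hasDerivAt_inclination R.ruling_unit hVt (R.hasDerivAt_ruling t) (hne t)
    have hVβ : inner ℝ (V t) (deriv R.ruling t) =
        inner ℝ (partialT R.param t (w t)) (deriv R.ruling t) := by
      rw [hVdef]
      simp only [inner_add_left, real_inner_smul_left, R.inner_ruling_deriv, mul_zero, add_zero]
    have hd : derivWithin θ (Icc a b) t = _ := (derivWithin_of_mem_nhds hnhds).trans h.deriv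
    dsimp only
    rw [hd, edgeIntegrand, geodesicCurvature, hev.deriv_eq,
      hev.self_of_nhds, unitNormal, partialU_param, hVβ, hcross, rotation]
    ring
  refine ⟨(hθi.sub hρi).congr_uIoo ?_, ?_⟩
  · rw [uIoo_of_le hab.le]
    exact hpt.symm
  have hftc : ∫ t in a..b, derivWithin θ (Icc a b) t = θ b - θ a :=
    intervalIntegral.integral_eq_sub_of_hasDerivAt_of_le hab.le hθ.continuousOn
      (fun t ht => ((hθ.differentiableOn one_ne_zero t
        (Ioo_subset_Icc_self ht)).hasDerivWithinAt).hasDerivAt (Icc_mem_nhds ht.1 ht.2)) hθi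
  have hb : θ b = R.edgeInclination w (Iic b) b := by
    rw [edgeInclination, ((hedge b (right_mem_Icc.2 hab.le)).mono_of_mem_nhdsWithin
      (Icc_mem_nhdsLE hab)).derivWithin (uniqueDiffWithinAt_Iic b)]
  have ha : θ a = R.edgeInclination w (Ici a) a := by
    rw [edgeInclination, ((hedge a (left_mem_Icc.2 hab.le)).mono_of_mem_nhdsWithin
      (Icc_mem_nhdsGE hab)).derivWithin (uniqueDiffWithinAt_Ici a)]
  rw [intervalIntegral.integral_congr_Ioo_of_le hab.le hpt,
    intervalIntegral.integral_sub hθi hρi, hftc, ha, hb]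
  -- The rotation is moved along the ruling to the lower edge, so that both edges yield the same
  -- term.
  congr 1
  exact intervalIntegral.integral_congr fun t _ =>
    R.rotation_eq (hmem t) (left_mem_Icc.2 (R.lower_lt_upper t).le)

end Edge


/-! ### The subdivision of a period -/

section Subdivision

variable (R : DevelopableRibbon)

/-- The points of subdivision, as a sequence that is continued by zeros. -/
def kinkSeq (j : ℕ) : ℝ := if h : j < R.pieces + 1 then R.kink ⟨j, h⟩ else 0

theorem kinkSeq_castSucc (i : Fin R.pieces) : R.kinkSeq i = R.kink i.castSucc :=
  dif_pos (i.castSucc).isLt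

theorem kinkSeq_succ (i : Fin R.pieces) : R.kinkSeq (i + 1) = R.kink i.succ :=
  dif_pos i.succ.isLt

theorem kinkSeq_zero : R.kinkSeq 0 = 0 :=
  (dif_pos (Nat.succ_pos _)).trans R.kink_zero

theorem kinkSeq_pieces : R.kinkSeq R.pieces = R.period :=
  (dif_pos (Nat.lt_succ_self _)).trans R.kink_last

theorem kinkSeq_lt {j : ℕ} (hj : j < R.pieces) : R.kinkSeq j < R.kinkSeq (j + 1) := by
  rw [R.kinkSeq_castSucc ⟨j, hj⟩, R.kinkSeq_succ ⟨j, hj⟩]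
  exact R.kink_strictMono Fin.castSucc_lt_succ

theorem lower_contDiffOn_kinkSeq {j : ℕ} (hj : j < R.pieces) :
    ContDiffOn ℝ 2 R.lower (Icc (R.kinkSeq j) (R.kinkSeq (j + 1))) := by
  rw [R.kinkSeq_castSucc ⟨j, hj⟩, R.kinkSeq_succ ⟨j, hj⟩]
  exact R.lower_contDiffOn _

theorem upper_contDiffOn_kinkSeq {j : ℕ} (hj : j < R.pieces) :
    ContDiffOn ℝ 2 R.upper (Icc (R.kinkSeq j) (R.kinkSeq (j + 1))) := by
  rw [R.kinkSeq_castSucc ⟨j, hj⟩, R.kinkSeq_succ ⟨j, hj⟩]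
  exact R.upper_contDiffOn _

theorem pieces_pos : 0 < R.pieces := by
  refine Nat.pos_of_ne_zero fun h => R.period_pos.ne ?_
  rw [← R.kinkSeq_pieces, h, R.kinkSeq_zero]

theorem exists_mem_kinkSeq {t : ℝ} (ht : t ∈ Ico 0 R.period) :
    ∃ j < R.pieces, t ∈ Icc (R.kinkSeq j) (R.kinkSeq (j + 1)) := by
  have key : ∀ m ≤ R.pieces, t < R.kinkSeq m →
      ∃ j < m, t ∈ Icc (R.kinkSeq j) (R.kinkSeq (j + 1)) := by
    intro m
    induction m with
    | zero => exact fun _ h => absurd ht.1 (not_le.2 (R.kinkSeq_zero ▸ h))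
    | succ m ih =>
      intro hm h
      rcases lt_or_ge t (R.kinkSeq m) with h1 | h1
      · obtain ⟨j, hj, hmem⟩ := ih (Nat.le_of_succ_le hm) h1
        exact ⟨j, hj.trans (Nat.lt_succ_self m), hmem⟩
      · exact ⟨m, Nat.lt_succ_self m, h1, h.le⟩
  exact key _ le_rfl (R.kinkSeq_pieces.symm ▸ ht.2)

/-- Over each closed piece of the subdivision the widths are continuous and the region between them
is closed; the domain is cut out of the finite union of these regions. -/
theorem measurableSet_domain : MeasurableSet R.domain := by
  have h : R.domain = {p : ℝ × ℝ | p.1 ∈ Ico 0 R.period} ∩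
      ⋃ j ∈ Finset.range R.pieces,
        (Icc (R.kinkSeq j) (R.kinkSeq (j + 1)) ×ˢ univ) ∩
          (fun p : ℝ × ℝ => (p.2 - R.lower p.1, R.upper p.1 - p.2)) ⁻¹' (Ici 0 ×ˢ Ici 0) := by
    ext p
    simp only [domain, mem_ofPred_eq, mem_inter_iff, mem_iUnion, Finset.mem_range, mem_prod,
      mem_univ, and_true, mem_preimage, mem_Ici, sub_nonneg]
    constructor
    · rintro ⟨h1, h2⟩
      obtain ⟨j, hj, hmem⟩ := R.exists_mem_kinkSeq h1
      exact ⟨h1, j, hj, hmem, h2⟩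
    · rintro ⟨h1, j, -, -, h2⟩
      exact ⟨h1, h2⟩
  rw [h]
  refine (measurable_fst measurableSet_Ico).inter
    (Finset.measurableSet_biUnion _ fun j hj => IsClosed.measurableSet ?_)
  have hj' := Finset.mem_range.1 hj
  have hmaps : MapsTo (Prod.fst : ℝ × ℝ → ℝ) (Icc (R.kinkSeq j) (R.kinkSeq (j + 1)) ×ˢ univ)
    (Icc (R.kinkSeq j) (R.kinkSeq (j + 1))) := fun p hp => hp.1
  refine ContinuousOn.preimage_isClosed_of_isClosed (ContinuousOn.prodMk ?_ ?_)
    (isClosed_Icc.prod isClosed_univ) (isClosed_Ici.prod isClosed_Ici)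
  · exact continuousOn_snd.sub
      ((R.lower_contDiffOn_kinkSeq hj').continuousOn.comp continuousOn_fst hmaps)
  · exact ((R.upper_contDiffOn_kinkSeq hj').continuousOn.comp continuousOn_fst hmaps).sub
      continuousOn_snd

/-! ### Vanishing surface term and existence of the integrals -/

theorem surfaceIntegrand_eq_zero {p : ℝ × ℝ} (hp : p ∈ R.domain) : R.surfaceIntegrand p = 0 :=
  mul_eq_zero_of_left (R.flat p.1 p.2 hp.2) _

theorem surfaceContribution_eq_zero : R.surfaceContribution = 0 :=
  setIntegral_eq_zero_of_forall_eq_zero fun _ hp => R.surfaceIntegrand_eq_zero hp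

theorem lower_mem_Icc (t : ℝ) : R.lower t ∈ Icc (R.lower t) (R.upper t) :=
  left_mem_Icc.2 (R.lower_lt_upper t).le

theorem upper_mem_Icc (t : ℝ) : R.upper t ∈ Icc (R.lower t) (R.upper t) :=
  right_mem_Icc.2 (R.lower_lt_upper t).le

theorem hasFiniteCurvature : R.HasFiniteCurvature := by
  have htr : ∀ w, (∀ j < R.pieces, IntervalIntegrable (R.edgeIntegrand w) volume
      (R.kinkSeq j) (R.kinkSeq (j + 1))) →
      IntervalIntegrable (R.edgeIntegrand w) volume 0 R.period := fun w h => by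
    have := IntervalIntegrable.trans_iterate h
    rwa [R.kinkSeq_zero, R.kinkSeq_pieces] at this
  refine ⟨integrableOn_zero.congr_fun (fun p hp => (R.surfaceIntegrand_eq_zero hp).symm)
    R.measurableSet_domain, htr _ fun j hj => ?_, htr _ fun j hj => ?_⟩
  · exact (R.integral_edgeIntegrand (R.kinkSeq_lt hj) (R.lower_contDiffOn_kinkSeq hj)
      R.lower_mem_Icc).1
  · exact (R.integral_edgeIntegrand (R.kinkSeq_lt hj) (R.upper_contDiffOn_kinkSeq hj)
      R.upper_mem_Icc).1

/-! ### One-sided differentiability of the widths at the points of subdivision -/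

variable {R}

theorem differentiableWithinAt_Ici_kinkSeq {w : ℝ → ℝ}
    (hw : ∀ j < R.pieces, ContDiffOn ℝ 2 w (Icc (R.kinkSeq j) (R.kinkSeq (j + 1))))
    {j : ℕ} (hj : j < R.pieces) : DifferentiableWithinAt ℝ w (Ici (R.kinkSeq j)) (R.kinkSeq j) :=
  ((hw j hj).differentiableOn two_ne_zero _
    (left_mem_Icc.2 (R.kinkSeq_lt hj).le)).mono_of_mem_nhdsWithin
    (Icc_mem_nhdsGE (R.kinkSeq_lt hj))

theorem differentiableWithinAt_Iic_kinkSeq_succ {w : ℝ → ℝ}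
    (hw : ∀ j < R.pieces, ContDiffOn ℝ 2 w (Icc (R.kinkSeq j) (R.kinkSeq (j + 1))))
    {j : ℕ} (hj : j < R.pieces) :
    DifferentiableWithinAt ℝ w (Iic (R.kinkSeq (j + 1))) (R.kinkSeq (j + 1)) :=
  ((hw j hj).differentiableOn two_ne_zero _
    (right_mem_Icc.2 (R.kinkSeq_lt hj).le)).mono_of_mem_nhdsWithin
    (Icc_mem_nhdsLE (R.kinkSeq_lt hj))

theorem differentiableWithinAt_Iic_period {w : ℝ → ℝ}
    (hw : ∀ j < R.pieces, ContDiffOn ℝ 2 w (Icc (R.kinkSeq j) (R.kinkSeq (j + 1)))) :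
    DifferentiableWithinAt ℝ w (Iic R.period) R.period := by
  have h := differentiableWithinAt_Iic_kinkSeq_succ hw (Nat.sub_one_lt R.pieces_pos.ne')
  rwa [Nat.sub_one_add_one R.pieces_pos.ne', R.kinkSeq_pieces] at h

/-- To the left of 0 the subdivision says nothing; `h0` will come from the gluing with the end of
the period. -/
theorem differentiableWithinAt_Iic_kinkSeq {w : ℝ → ℝ}
    (hw : ∀ j < R.pieces, ContDiffOn ℝ 2 w (Icc (R.kinkSeq j) (R.kinkSeq (j + 1))))
    (h0 : DifferentiableWithinAt ℝ w (Iic 0) 0) {j : ℕ} (hj : j < R.pieces) :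
    DifferentiableWithinAt ℝ w (Iic (R.kinkSeq j)) (R.kinkSeq j) := by
  cases j with
  | zero => rwa [R.kinkSeq_zero]
  | succ j => exact differentiableWithinAt_Iic_kinkSeq_succ hw (Nat.lt_of_succ_lt hj)

variable (R)

/-- The edge and kink contributions of the pieces of both edges telescope. -/
theorem totalCurvature_eq (hl : DifferentiableWithinAt ℝ R.lower (Iic 0) 0)
    (hu : DifferentiableWithinAt ℝ R.upper (Iic 0) 0) :
    R.totalCurvature =
      (R.edgeInclination R.lower (Iic R.period) R.period -
        R.edgeInclination R.upper (Iic R.period) R.period) -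
      (R.edgeInclination R.lower (Iic 0) 0 - R.edgeInclination R.upper (Iic 0) 0) := by
  have hL := fun j (hj : j < R.pieces) => R.lower_contDiffOn_kinkSeq hj
  have hU := fun j (hj : j < R.pieces) => R.upper_contDiffOn_kinkSeq hj
  have iL := fun j (hj : j < R.pieces) =>
    R.integral_edgeIntegrand (R.kinkSeq_lt hj) (hL j hj) R.lower_mem_Icc
  have iU := fun j (hj : j < R.pieces) =>
    R.integral_edgeIntegrand (R.kinkSeq_lt hj) (hU j hj) R.upper_mem_Icc
  have sL := intervalIntegral.sum_integral_adjacent_intervals fun j hj => (iL j hj).1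
  have sU := intervalIntegral.sum_integral_adjacent_intervals fun j hj => (iU j hj).1
  rw [R.kinkSeq_zero, R.kinkSeq_pieces] at sL sU
  have hk : R.kinkContribution = ∑ j ∈ Finset.range R.pieces,
      (R.turningAngle R.lower (R.kinkSeq j) - R.turningAngle R.upper (R.kinkSeq j)) := by
    rw [Finset.sum_range]
    simp only [kinkContribution, kinkSeq_castSucc]
  have htel := Finset.sum_range_sub (fun j =>
    R.edgeInclination R.lower (Iic (R.kinkSeq j)) (R.kinkSeq j) -
      R.edgeInclination R.upper (Iic (R.kinkSeq j)) (R.kinkSeq j)) R.pieces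
  rw [R.kinkSeq_zero, R.kinkSeq_pieces] at htel
  rw [totalCurvature, surfaceContribution_eq_zero, edgeContribution, zero_add, hk, ← sL, ← sU,
    ← Finset.sum_sub_distrib, ← Finset.sum_add_distrib, ← htel]
  -- The jump at the start of a piece plus the increment along it is the change between left-sided
  -- inclinations at consecutive kinks; the rotation integrals cancel.
  refine Finset.sum_congr rfl fun j hj => ?_
  have hj' := Finset.mem_range.1 hj
  rw [(iL j hj').2, (iU j hj').2,
    R.turningAngle_eq (R.lower_mem_Icc _) (differentiableWithinAt_Iic_kinkSeq hL hl hj')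
      (differentiableWithinAt_Ici_kinkSeq hL hj'),
    R.turningAngle_eq (R.upper_mem_Icc _) (differentiableWithinAt_Iic_kinkSeq hU hu hj')
      (differentiableWithinAt_Ici_kinkSeq hU hj')]
  ring

end Subdivision

/-! ### Closing up after a period -/

section Closing

variable {R : DevelopableRibbon}

theorem differentiableWithinAt_Iic_comp_add {f : ℝ → ℝ} {a : ℝ}
    (h : DifferentiableWithinAt ℝ f (Iic a) a) :
    DifferentiableWithinAt ℝ (fun t => f (t + a)) (Iic 0) 0 := by
  refine DifferentiableWithinAt.comp (t := Iic a) 0 ?_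
    (differentiableAt_id.add_const a).differentiableWithinAt fun t ht => ?_
  · simpa using h
  · simpa using ht

open scoped Pointwise in
theorem derivWithin_Iic_of_comp_add {f g : ℝ → E3} {a : ℝ} (h : ∀ t, f (t + a) = g t) :
    derivWithin f (Iic a) a = derivWithin g (Iic 0) 0 := by
  have h1 := derivWithin_comp_add_const f a (Iic 0) 0
  have h2 : a +ᵥ Iic (0 : ℝ) = Iic a := by
    ext t
    simp [mem_vadd_set_iff_neg_vadd_mem]
  rw [h2, zero_add] at h1
  rw [← h1]
  congr 1
  exact funext h

theorem IsCylindrical.totalCurvature_eq_zero (h : R.IsCylindrical) : R.totalCurvature = 0 := by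
  obtain ⟨hr, hl, hu⟩ := h
  have e : ∀ w : ℝ → ℝ, (∀ t, w (t + R.period) = w t) →
      R.edgeInclination w (Iic R.period) R.period = R.edgeInclination w (Iic 0) 0 := by
    intro w hw
    have hr0 := hr 0
    rw [zero_add] at hr0
    rw [edgeInclination, edgeInclination, hr0, derivWithin_Iic_of_comp_add fun t => ?_]
    rw [edge, edge, param, param, R.center_closed, hr, hw]
  have dl := differentiableWithinAt_Iic_comp_add
    (differentiableWithinAt_Iic_period fun j hj => R.lower_contDiffOn_kinkSeq hj)
  have du := differentiableWithinAt_Iic_comp_add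
    (differentiableWithinAt_Iic_period fun j hj => R.upper_contDiffOn_kinkSeq hj)
  simp only [hl] at dl
  simp only [hu] at du
  rw [R.totalCurvature_eq dl du, e _ hl, e _ hu, sub_self]

theorem IsMobius.totalCurvature_eq_zero (h : R.IsMobius) : R.totalCurvature = 0 := by
  obtain ⟨hr, hl, hu⟩ := h
  have e : ∀ w v : ℝ → ℝ, (∀ t, w (t + R.period) = -v t) →
      R.edgeInclination w (Iic R.period) R.period = -R.edgeInclination v (Iic 0) 0 := by
    intro w v hw
    have hr0 := hr 0
    rw [zero_add] at hr0
    rw [edgeInclination, edgeInclination, hr0, inclination_neg_right,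
      derivWithin_Iic_of_comp_add fun t => ?_]
    -- The signs of width and ruling cancel: one edge after a turn is the other edge, as a curve in
    -- space.
    rw [edge, edge, param, param, R.center_closed, hr, hw, neg_smul_neg]
  -- Before 0 the lower width is minus the upper width one period later, and conversely.
  have dl := (differentiableWithinAt_Iic_comp_add
    (differentiableWithinAt_Iic_period fun j hj => R.upper_contDiffOn_kinkSeq hj)).fun_neg
  have du := (differentiableWithinAt_Iic_comp_add
    (differentiableWithinAt_Iic_period fun j hj => R.lower_contDiffOn_kinkSeq hj)).fun_neg
  simp only [hu, neg_neg] at dl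
  simp only [hl, neg_neg] at du
  rw [R.totalCurvature_eq dl du, e _ _ hl, e _ _ hu]
  ring

end Closing

end DevelopableRibbon
end Ribbon

end

theorem mainTheorem6 :
    (∀ R : Ribbon.DevelopableRibbon, R.IsCylindrical →
      R.HasFiniteCurvature ∧ R.totalCurvature = 0) ∧
    (∀ R : Ribbon.DevelopableRibbon, R.IsMobius →
      R.HasFiniteCurvature ∧ R.totalCurvature = 0) := by
  exact ⟨fun R h => ⟨R.hasFiniteCurvature, h.totalCurvature_eq_zero⟩,
    fun R h => ⟨R.hasFiniteCurvature, h.totalCurvature_eq_zero⟩⟩
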